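/- Let $n\ge 2$ and let $\Phi\in\mathbb R^{1\times n}$ be a row vector. For $m\ge1$ let $A_m\in\mathbb R^{m\times m}$ be the matrix with ones on the first superdiagonal and zeros elsewhere, $B_m=(0,\dots,0,1)^\top\in\mathbb R^m$, $C_m=(1,0,\dots,0)\in\mathbb R^{1\times m}$ and $D_m(\ell)=\mathrm{diag}(\ell,\ell^2,\dots,\ell^m)$; write $A,B,C$ for $A_2,B_2,C_2$, and let $N=\begin{pmatrix}0&0\\0&1\end{pmatrix}$. Consider the linear system with noisy output $$\dot x=A_nx+B_n\Phi x,\qquad y=C_nx+\nu(t),\qquad \nu(t)=a_N\sin(\omega_Nt+f_N),$$ the standard high-gain observer $$\dot{\hat x}=A_n\hat x+B_n\Phi\hat x+D_n(\ell)K_n(C_n\hat x-y),\qquad K_n\in\mathbb R^n,$$ and the observer with state $\xi=\mathrm{col}(\xi_1,\dots,\xi_{n-1})$, $\xi_i\in\mathbb R^2$, $$\dot\xi_i=A\xi_i+N\xi_{i+1}+D_2(\ell)K_ie_i\quad(1\le i\le n-2),\qquad \dot\xi_{n-1}=A\xi_{n-1}+B\Phi\hat x'+D_2(\ell)K_{n-1}e_{n-1},$$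 where $K_i\in\mathbb R^2$ for $1\le i\le n-1$, $e_1=y-C\xi_1$, $e_i=B^\top\xi_{i-1}-C\xi_i$ for $2\le i\le n-1$, and $\hat x'=(C\xi_1,\dots,C\xi_{n-2},\xi_{n-1}^\top)^\top\in\mathbb R^n$ is the estimate of $x$. (For the standard observer, $K_n$ denotes the gain in $\mathbb R^n$, separate from the gains $K_1,\dots,K_{n-1}\in\mathbb R^2$.) Let $\ell\neq0$ and the gains be fixed so that all entries of $K_n$ are nonzero (which holds whenever $A_n+K_nC_n$ is Hurwitz) and so that the error dynamics of both observers are Hurwitz. That is, in the absence of noise the errors $\hat x-x$ and $\mathrm{col}\big(\xi_i-(x_i,x_{i+1})^\top\big)_{i=1}^{n-1}$ satisfy linear autonomous differential equations, and all eigenvalues of their matrices have negative real part. Let $\rho\in\{1,\dots,n\}$ be the position of the first nonzero entry of $\Phi$ (with $\rho=n$ if $\Phi=0$), and let $$r_i'=\min\{\,i,\;n-1,\;\rho+n-i+1\,\},\qquad i=1,\dots,n.$$ Then $r_i'\ge1$ for all $i$, and there exist $\omega_N^\star>0$ and $\bar c_1,\dots,\bar c_n>0$, depending only on $n$, $\Phi$,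 $\ell$ and the gains, such that for all $\omega_N>\omega_N^\star$, all $a_N>0$, all $f_N\in\mathbb R$ and all solutions $x$, $\hat x$, $\xi$ on $[0,\infty)$ (with arbitrary initial conditions), both limits superior below are finite, the denominator is positive, and $$\frac{\limsup_{t\to+\infty}|\hat x_i'(t)-x_i(t)|}{\limsup_{t\to+\infty}|\hat x_i(t)-x_i(t)|}\;\le\;\bar c_i\,\omega_N^{-(r_i'-1)}\qquad\text{for all } i=1,\dots,n.$$ -/

import Mathlib

open Matrix

namespace HighGain

noncomputable section

/-- The matrix `A_m` of the prime form: ones on the first superdiagonal, zeros elsewhere. -/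
def primeA (m : ℕ) : Matrix (Fin m) (Fin m) ℝ :=
  Matrix.of fun i j => if j.val = i.val + 1 then 1 else 0

/-- The column `B_m = (0, …, 0, 1)ᵀ` of the prime form. -/
def primeB (m : ℕ) : Fin m → ℝ := fun i => if i.val + 1 = m then 1 else 0

/-- The row `C_m = (1, 0, …, 0)` of the prime form. -/
def primeC (m : ℕ) : Fin m → ℝ := fun i => if i.val = 0 then 1 else 0

/-- The gain matrix `D_m(ℓ) = diag(ℓ, ℓ², …, ℓ^m)`. -/
def gainD (m : ℕ) (ℓ : ℝ) : Matrix (Fin m) (Fin m) ℝ :=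
  Matrix.diagonal fun i => ℓ ^ (i.val + 1)

/-- The `2 × 2` matrix `N` coupling `ξ_{i+1}` into the equation of `ξ_i`. -/
def matN : Matrix (Fin 2) (Fin 2) ℝ := !![0, 0; 0, 1]

/-- A real square matrix is Hurwitz if all its complex eigenvalues have negative real part. -/
def IsHurwitz {κ : Type*} [Fintype κ] [DecidableEq κ] (M : Matrix κ κ ℝ) : Prop :=
  ∀ μ ∈ spectrum ℂ (M.map ((↑) : ℝ → ℂ)), μ.re < 0

/-- Index set of the state `ξ = col(ξ_1, …, ξ_{n-1})`, `ξ_i ∈ ℝ²`, of the new observer: the pair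
`(i, a)` is the entry `a` of the block `ξ_i` (both counted from `0`). -/
abbrev Idx (n : ℕ) : Type := Fin (n - 1) × Fin 2

/-- The block `ξ_i ∈ ℝ²` of `ξ`. -/
def block {n : ℕ} (ξ : Idx n → ℝ) (i : Fin (n - 1)) : Fin 2 → ℝ := fun a => ξ (i, a)

/-- `L_1 = blkdiag(C, …, C, I_2)`, with `n - 2` copies of `C = (1 0)`: its first `n - 1` rows select
the first entries of the blocks, its last row selects the second entry of the last block. -/
def matL (n : ℕ) : Matrix (Fin n) (Idx n) ℝ :=
  Matrix.of fun i p =>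
    if (p.1.val = i.val ∧ p.2 = 0) ∨ (i.val + 1 = n ∧ p.1.val + 2 = n ∧ p.2 = 1) then 1 else 0

/-- The observed plant `ẋ = A_n x + B_n Φ x`. -/
def plantField {n : ℕ} (Φ : Fin n → ℝ) (x : Fin n → ℝ) : Fin n → ℝ :=
  primeA n *ᵥ x + (Φ ⬝ᵥ x) • primeB n

/-- The measured output `y = C_n x + ν`, for the value `ν` of the noise. -/
def output {n : ℕ} (x : Fin n → ℝ) (ν : ℝ) : ℝ := primeC n ⬝ᵥ x + ν

/-- The sinusoidal measurement noise `ν(t) = a sin(ω t + f)`. -/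
def noise (a ω f t : ℝ) : ℝ := a * Real.sin (ω * t + f)

/-- The standard high-gain observer
`d/dt x̂ = A_n x̂ + B_n Φ x̂ + D_n(ℓ) K_n (C_n x̂ - y)`. -/
def standardField {n : ℕ} (Φ K : Fin n → ℝ) (ℓ y : ℝ) (z : Fin n → ℝ) : Fin n → ℝ :=
  primeA n *ᵥ z + (Φ ⬝ᵥ z) • primeB n + (primeC n ⬝ᵥ z - y) • (gainD n ℓ *ᵥ K)

/-- The injection terms `e_1 = y - C ξ_1` and `e_i = Bᵀ ξ_{i-1} - C ξ_i` for `i ≥ 2`. -/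
def innov {n : ℕ} (y : ℝ) (ξ : Idx n → ℝ) (i : Fin (n - 1)) : ℝ :=
  (if i.val = 0 then y
    else primeB 2 ⬝ᵥ block ξ ⟨i.val - 1, lt_of_le_of_lt (Nat.sub_le _ _) i.isLt⟩)
    - primeC 2 ⬝ᵥ block ξ i

/-- The new observer, of dimension `2n - 2`:
`d/dt ξ_i = A ξ_i + N ξ_{i+1} + D_2(ℓ) K_i e_i` for `i ≤ n - 2` and
`d/dt ξ_{n-1} = A ξ_{n-1} + B Φ x̂' + D_2(ℓ) K_{n-1} e_{n-1}`, where `x̂' = L_1 ξ`. -/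
def newField {n : ℕ} (Φ : Fin n → ℝ) (k : Fin (n - 1) → Fin 2 → ℝ) (ℓ y : ℝ)
    (ξ : Idx n → ℝ) : Idx n → ℝ := fun p =>
  (primeA 2 *ᵥ block ξ p.1
    + (if h : p.1.val + 1 < n - 1 then matN *ᵥ block ξ ⟨p.1.val + 1, h⟩
        else (Φ ⬝ᵥ (matL n *ᵥ ξ)) • primeB 2)
    + innov y ξ p.1 • (gainD 2 ℓ *ᵥ k p.1)) p.2

/-- The matrix `A_n + B_n Φ + D_n(ℓ) K_n C_n` of the dynamics of the error `x̂ - x` of the standard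
observer. -/
def standardErrorMatrix {n : ℕ} (Φ K : Fin n → ℝ) (ℓ : ℝ) : Matrix (Fin n) (Fin n) ℝ :=
  primeA n + vecMulVec (primeB n) Φ + vecMulVec (gainD n ℓ *ᵥ K) (primeC n)

/-- The matrix of the dynamics of the error `ξ̃ = col(ξ_i - (x_i, x_{i+1}))_i` of the new observer.
It is block tridiagonal, with diagonal blocks `A - D_2(ℓ) K_i C`, upper blocks `N` and lower blocks
`D_2(ℓ) K_i Bᵀ`, plus the term `B Φ L_1` in the last block row. -/
def newErrorMatrix {n : ℕ} (Φ : Fin n → ℝ) (k : Fin (n - 1) → Fin 2 → ℝ) (ℓ : ℝ) :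
    Matrix (Idx n) (Idx n) ℝ :=
  Matrix.of fun p q =>
    (if q.1.val = p.1.val then
        (primeA 2 - vecMulVec (gainD 2 ℓ *ᵥ k p.1) (primeC 2)) p.2 q.2
      else if q.1.val = p.1.val + 1 then matN p.2 q.2
      else if q.1.val + 1 = p.1.val then
        vecMulVec (gainD 2 ℓ *ᵥ k p.1) (primeB 2) p.2 q.2
      else 0)
    + (if p.1.val + 2 = n then primeB 2 p.2 * (Φ ᵥ* matL n) q else 0)

open Classical in
/-- The position `ρ ∈ {1, …, n}` of the first nonzero entry of `Φ`, and `ρ = n` if `Φ = 0`. -/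
def rho {n : ℕ} (Φ : Fin n → ℝ) : ℕ :=
  if h : (Finset.univ.filter fun j => Φ j ≠ 0).Nonempty then
    (Finset.min' _ h).val + 1
  else n

/-- `r_i' = min {i, n - 1, ρ + n - i + 1}`, where `i` is counted from `1`, that is, the index
`i : Fin n` stands for the position `i + 1`. -/
def relDeg {n : ℕ} (Φ : Fin n → ℝ) (i : Fin n) : ℕ :=
  min (i.val + 1) (min (n - 1) (rho Φ + (n - (i.val + 1)) + 1))

end

end HighGain

/-!
Both observer errors satisfy a linear equation `e' = M e + ν(t) b` with `M` Hurwitz, where `ν` is the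
sinusoidal noise; for the new observer this uses that the lifted state `(x_i, x_{i+1})_i` of the plant
is a noise-free solution (`newField_stateIdx`). The homogeneous part decays
(`IsHurwitz.tendsto_zero`), so the error approaches the steady-state response, whose amplitude
`w = u + i v` solves `(i ω - M) w = b` (`IsHurwitz.tendsto_sub_steadyState`).

The claim is thus about the order of `w` as `ω → ∞`. Reading `w = (M w + b) / (i ω)` row by row, a
coordinate that the input `b` reaches only after `δ` steps through the nonzero entries of `M` is
`O(ω ^ -(δ + 1))` (`exists_steadyState_le`), while a coordinate that `b` enters directly has order
at least `ω⁻¹` (`exists_le_steadyState`). In the standard observer the gain vector has no zero entry,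
so every coordinate is of the second kind. In the new observer the noise enters the first block only
and reaches the estimate of `x_i` after at least `r_i' - 1` steps
(`delay_le_of_newErrorMatrix_ne_zero`, `relDeg_le_delay_add_one`): either forward through the
injection terms, or through the feedback `Φ` into the last block and backward from there.
-/

namespace HighGain

section LinearSystems

open Filter Topology Set

/-! ### Decay of solutions of Hurwitz systems -/

/-- A function whose `m`-th derivative vanishes on `[0, ∞)` grows at most like `(1 + t) ^ m`. The
successive derivatives are given as a sequence `p`. -/
theorem exists_norm_le_pow_of_deriv_chain (m : ℕ) : ∀ p : ℕ → ℝ → ℂ,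
    (∀ k, ∀ t ∈ Ici (0 : ℝ), HasDerivWithinAt (p k) (p (k + 1) t) (Ici 0) t) →
    (∀ t ∈ Ici (0 : ℝ), p m t = 0) →
    ∃ C : ℝ, 0 ≤ C ∧ ∀ t ∈ Ici (0 : ℝ), ‖p 0 t‖ ≤ C * (1 + t) ^ m := by
  induction m with
  | zero => exact fun p _ h0 => ⟨0, le_rfl, fun t ht => by simp [h0 t ht]⟩
  | succ m ih =>
    intro p hp h0
    obtain ⟨C, hC, hb⟩ := ih (fun k => p (k + 1)) (fun k => hp (k + 1)) h0
    refine ⟨‖p 0 0‖ + C, by positivity, fun t ht => ?_⟩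
    have ht' : (0 : ℝ) ≤ t := ht
    have key := norm_image_sub_le_of_norm_deriv_le_segment' (f := p 0) (a := 0) (b := t)
      (C := C * (1 + t) ^ m)
      (fun s hs => (hp 0 s hs.1).mono Icc_subset_Ici_self)
      (fun s hs => (hb s hs.1).trans (by
        have := hs.1
        have := hs.2.le
        gcongr)) t ⟨ht', le_rfl⟩
    have h1 : ‖p 0 t‖ ≤ ‖p 0 t - p 0 0‖ + ‖p 0 0‖ := by
      simpa using norm_add_le (p 0 t - p 0 0) (p 0 0)
    have h2 : (1 : ℝ) ≤ (1 + t) ^ (m + 1) := one_le_pow₀ (by linarith)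
    have h3 : 0 ≤ C * (1 + t) ^ m := by positivity
    have h4 : ‖p 0 0‖ ≤ ‖p 0 0‖ * (1 + t) ^ (m + 1) := le_mul_of_one_le_right (norm_nonneg _) h2
    have h5 : (‖p 0 0‖ + C) * (1 + t) ^ (m + 1) =
        ‖p 0 0‖ * (1 + t) ^ (m + 1) + C * (1 + t) ^ m * (1 + t) := by ring
    nlinarith

theorem tendsto_pow_mul_exp_atTop_nhds_zero (m : ℕ) {r : ℝ} (hr : r < 0) :
    Tendsto (fun t : ℝ => (1 + t) ^ m * Real.exp (r * t)) atTop (𝓝 0) := by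
  have h := (Polynomial.tendsto_div_exp_atTop
    ((1 + Polynomial.C (-r)⁻¹ * Polynomial.X) ^ m)).comp
      (tendsto_id.const_mul_atTop (neg_pos.2 hr))
  refine h.congr fun t => ?_
  have h1 : (-r)⁻¹ * (-r * t) = t := by
    have := hr.ne
    field_simp
  simp only [Function.comp, id, Polynomial.eval_pow, Polynomial.eval_add, Polynomial.eval_one,
    Polynomial.eval_mul, Polynomial.eval_C, Polynomial.eval_X, h1]
  rw [div_eq_mul_inv, ← Real.exp_neg]
  congr 2
  ring

variable {κ : Type*} [Fintype κ] [DecidableEq κ]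

/-- Along a solution of `d' = M d`, a functional `φ` in a generalized eigenspace of `Mᵀ` decays if
its eigenvalue `μ` has negative real part: with `T = Mᵀ - μ`, the functions
`exp (-μ t) * (Tᵏ φ) (d t)` form a chain of successive derivatives that ends in `0`, so they grow
at most polynomially. -/
theorem tendsto_dotProduct_of_mem_maxGenEigenspace {M : Matrix κ κ ℂ} {d : ℝ → κ → ℂ}
    (hd : ∀ t ∈ Ici (0 : ℝ), HasDerivWithinAt d (M *ᵥ d t) (Ici 0) t) {μ : ℂ} (hμ : μ.re < 0)
    {φ : κ → ℂ} (hφ : φ ∈ Module.End.maxGenEigenspace (toLin' Mᵀ) μ) :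
    Tendsto (fun t => φ ⬝ᵥ d t) atTop (𝓝 0) := by
  obtain ⟨m, hm⟩ := (Module.End.mem_maxGenEigenspace _ _ _).1 hφ
  set T : Module.End ℂ (κ → ℂ) := toLin' Mᵀ - μ • 1 with hT
  set p : ℕ → ℝ → ℂ := fun k t => Complex.exp (-μ * t) * ((T ^ k) φ ⬝ᵥ d t) with hp
  have hderiv : ∀ k, ∀ t ∈ Ici (0 : ℝ),
      HasDerivWithinAt (p k) (p (k + 1) t) (Ici 0) t := by
    intro k t ht
    have h1 : HasDerivWithinAt (fun t : ℝ => Complex.exp (-μ * t))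
        (Complex.exp (-μ * t) * (-μ)) (Ici 0) t := by
      have := ((hasDerivAt_id t).ofReal_comp.const_mul (-μ)).cexp
      simpa using this.hasDerivWithinAt
    have h2 : HasDerivWithinAt (fun t => (T ^ k) φ ⬝ᵥ d t) ((T ^ k) φ ⬝ᵥ (M *ᵥ d t))
        (Ici 0) t :=
      HasDerivWithinAt.fun_sum fun i _ =>
        ((hasDerivWithinAt_pi.1 (hd t ht)) i).const_mul _
    refine (h1.mul h2).congr_deriv ?_
    have h3 : (T ^ (k + 1)) φ = Mᵀ *ᵥ (T ^ k) φ - μ • (T ^ k) φ := by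
      rw [pow_succ', Module.End.mul_apply]
      simp [hT]
    simp only [hp, h3, sub_dotProduct, smul_dotProduct, mulVec_transpose, dotProduct_mulVec,
      smul_eq_mul]
    ring
  obtain ⟨C, hC, hb⟩ := exists_norm_le_pow_of_deriv_chain m p hderiv (fun t _ => by simp [hp, hm])
  have hlim := (tendsto_pow_mul_exp_atTop_nhds_zero m hμ).const_mul C
  rw [mul_zero] at hlim
  refine squeeze_zero_norm' ?_ hlim
  filter_upwards [eventually_ge_atTop 0] with t ht
  have h1 : φ ⬝ᵥ d t = Complex.exp (μ * t) * p 0 t := by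
    simp only [hp, ← mul_assoc, ← Complex.exp_add]
    simp
  have h2 : ‖Complex.exp (μ * t)‖ = Real.exp (μ.re * t) := by simp [Complex.norm_exp]
  rw [h1, norm_mul, h2]
  calc _ ≤ Real.exp (μ.re * t) * (C * (1 + t) ^ m) := by gcongr; exact hb t ht
    _ = _ := by ring

/-- Solutions of `d' = M d` with `M` Hurwitz tend to zero: the functionals that tend to zero along
the complexified solution form a subspace, which contains every generalized eigenspace of `Mᵀ`
and is therefore everything. -/
theorem IsHurwitz.tendsto_zero {M : Matrix κ κ ℝ} (hM : IsHurwitz M) {d : ℝ → κ → ℝ}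
    (hd : ∀ t ∈ Ici (0 : ℝ), HasDerivWithinAt d (M *ᵥ d t) (Ici 0) t) (i : κ) :
    Tendsto (fun t => d t i) atTop (𝓝 0) := by
  set Mc : Matrix κ κ ℂ := M.map ((↑) : ℝ → ℂ) with hMc
  set dc : ℝ → κ → ℂ := fun t j => (d t j : ℂ) with hdc
  have hdc' : ∀ t ∈ Ici (0 : ℝ), HasDerivWithinAt dc (Mc *ᵥ dc t) (Ici 0) t := by
    intro t ht
    rw [hasDerivWithinAt_pi]
    intro j
    have := (hasDerivWithinAt_pi.1 (hd t ht) j).ofReal_comp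
    refine this.congr_deriv ?_
    simp [hMc, hdc, mulVec, dotProduct]
  let S : Submodule ℂ (κ → ℂ) :=
    { carrier := {φ | Tendsto (fun t => φ ⬝ᵥ dc t) atTop (𝓝 0)}
      add_mem' := fun {φ ψ} h1 h2 => by
        have := Tendsto.add h1 h2
        simpa [add_dotProduct] using this
      zero_mem' := by simp
      smul_mem' := fun c φ h => by
        have := Tendsto.const_mul c h
        simpa [smul_dotProduct] using this }
  have hS : S = ⊤ := by
    rw [eq_top_iff, ← Module.End.iSup_maxGenEigenspace_eq_top (toLin' Mcᵀ)]
    refine iSup_le fun μ φ hφ => ?_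
    -- A nonzero generalized eigenvector is needed for `μ` to be in the spectrum.
    by_cases hz : φ = 0
    · exact hz ▸ S.zero_mem
    refine tendsto_dotProduct_of_mem_maxGenEigenspace hdc' (hM μ ?_) hφ
    obtain ⟨m, hm⟩ := (Module.End.mem_maxGenEigenspace _ _ _).1 hφ
    have hev : Module.End.HasEigenvalue (toLin' Mcᵀ) μ := by
      refine Module.End.hasEigenvalue_of_hasGenEigenvalue (k := m) fun hbot => hz ?_
      rw [← Submodule.mem_bot ℂ, ← hbot, Module.End.mem_genEigenspace_nat]
      exact hm
    have h1 : μ ∈ spectrum ℂ Mcᵀ := by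
      rw [← spectrum_toLin']
      exact hev.mem_spectrum
    rw [spectrum.mem_iff] at h1 ⊢
    intro h2
    apply h1
    have h3 := (isUnit_transpose _).2 h2
    rwa [transpose_sub, algebraMap_eq_diagonal, diagonal_transpose] at h3
  have h1 : Pi.single i 1 ∈ S := hS ▸ Submodule.mem_top
  have h2 : Tendsto (fun t => (d t i : ℂ)) atTop (𝓝 0) := by
    have : Tendsto (fun t => Pi.single i 1 ⬝ᵥ dc t) atTop (𝓝 0) := h1
    simpa [hdc] using this
  exact (Complex.continuous_re.tendsto 0).comp h2

/-! ### Steady-state response to a sinusoid -/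

/-- The amplitudes of the steady-state response `u sin (ω t + f) + v cos (ω t + f)` of
`e' = M e + sin (ω t + f) b`: the vector `w = u + i v` solves `(i ω - M) w = b`, which is possible
because a Hurwitz matrix has no eigenvalue on the imaginary axis. -/
theorem IsHurwitz.exists_steadyState {M : Matrix κ κ ℝ} (hM : IsHurwitz M) (b : κ → ℝ) (ω : ℝ) :
    ∃ u v : κ → ℝ, M *ᵥ u + b = -ω • v ∧ M *ᵥ v = ω • u := by
  set Mc : Matrix κ κ ℂ := M.map ((↑) : ℝ → ℂ) with hMc
  set R : Matrix κ κ ℂ := algebraMap ℂ _ (Complex.I * ω) - Mc with hR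
  have hu : IsUnit R := by
    by_contra h
    simpa using hM _ (spectrum.mem_iff.2 h)
  set w : κ → ℂ := R⁻¹ *ᵥ fun j => (b j : ℂ) with hw
  have h1 : R *ᵥ w = fun j => (b j : ℂ) := by
    rw [hw, mulVec_mulVec, Matrix.mul_nonsing_inv _ ((isUnit_iff_isUnit_det _).1 hu), one_mulVec]
  have h2 : ∀ j, Complex.I * ω * w j - ∑ q, (M j q : ℂ) * w q = b j := by
    intro j
    have := congrFun h1 j
    rw [hR, sub_mulVec, algebraMap_eq_diagonal] at this
    simpa [mulVec_diagonal, hMc, mulVec, dotProduct, diagonal_apply] using this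
  refine ⟨fun j => (w j).re, fun j => (w j).im, ?_, ?_⟩ <;> ext j
  · have := congrArg Complex.re (h2 j)
    simp at this
    simp [mulVec, dotProduct]
    linarith
  · have := congrArg Complex.im (h2 j)
    simp at this
    simp [mulVec, dotProduct]
    linarith

/-- Every solution of `e' = M e + ν(t) b` converges to the steady-state response, since the
difference of the two solves the homogeneous equation. -/
theorem IsHurwitz.tendsto_sub_steadyState {M : Matrix κ κ ℝ} (hM : IsHurwitz M)
    {b u v : κ → ℝ} {a ω f : ℝ} (hu : M *ᵥ u + b = -ω • v) (hv : M *ᵥ v = ω • u)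
    {e : ℝ → κ → ℝ}
    (he : ∀ t ∈ Ici (0 : ℝ), HasDerivWithinAt e (M *ᵥ e t + noise a ω f t • b) (Ici 0) t)
    (i : κ) :
    Tendsto (fun t => e t i - a * (u i * Real.sin (ω * t + f) + v i * Real.cos (ω * t + f)))
      atTop (𝓝 0) := by
  set s : ℝ → κ → ℝ := fun t =>
    (a * Real.sin (ω * t + f)) • u + (a * Real.cos (ω * t + f)) • v with hs
  have hds : ∀ t, HasDerivAt s (M *ᵥ s t + noise a ω f t • b) t := by
    intro t
    have h0 : HasDerivAt (fun t => ω * t + f) ω t := by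
      simpa using ((hasDerivAt_id t).const_mul ω).add_const f
    have h1 := ((h0.sin.const_mul a).smul_const u).add ((h0.cos.const_mul a).smul_const v)
    refine h1.congr_deriv ?_
    have hu' : M *ᵥ u = -ω • v - b := eq_sub_of_add_eq hu
    simp only [hs, mulVec_add, mulVec_smul, hu', hv, noise]
    ext j
    simp
    ring
  have hd := hM.tendsto_zero (d := fun t => e t - s t) (fun t ht => by
    refine ((he t ht).sub (hds t).hasDerivWithinAt).congr_deriv ?_
    rw [mulVec_sub]
    abel) i
  refine hd.congr fun t => ?_
  simp [hs]
  ring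

/-- Two-sided estimate of the asymptotic amplitude of a function that approaches a sinusoid. The
exact amplitude is `a * √(u² + v²)`; these cruder bounds suffice for orders of magnitude in `ω`. -/
theorem limsup_abs_of_tendsto_sub_sinusoid {g : ℝ → ℝ} {a u v ω f : ℝ} (ha : 0 < a) (hω : 0 < ω)
    (hg : Tendsto (fun t => g t - a * (u * Real.sin (ω * t + f) + v * Real.cos (ω * t + f)))
      atTop (𝓝 0)) :
    IsBoundedUnder (· ≤ ·) atTop (fun t => |g t|) ∧
      a * |v| ≤ limsup (fun t => |g t|) atTop ∧
      limsup (fun t => |g t|) atTop ≤ a * (|u| + |v|) := by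
  have hup : ∀ ε > 0, ∀ᶠ t in atTop, |g t| ≤ a * (|u| + |v|) + ε := by
    intro ε hε
    filter_upwards [Metric.tendsto_nhds.1 hg ε hε] with t ht
    rw [Real.dist_eq, sub_zero] at ht
    have h1 : |u * Real.sin (ω * t + f) + v * Real.cos (ω * t + f)| ≤ |u| + |v| := by
      refine (abs_add_le _ _).trans ?_
      rw [abs_mul, abs_mul]
      exact add_le_add (mul_le_of_le_one_right (abs_nonneg _) (Real.abs_sin_le_one _))
        (mul_le_of_le_one_right (abs_nonneg _) (Real.abs_cos_le_one _))
    have h2 := abs_sub_abs_le_abs_sub (g t)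
      (a * (u * Real.sin (ω * t + f) + v * Real.cos (ω * t + f)))
    rw [abs_mul, abs_of_pos ha] at h2
    have h3 := mul_le_mul_of_nonneg_left h1 ha.le
    linarith
  have hbdd : IsBoundedUnder (· ≤ ·) atTop (fun t => |g t|) :=
    isBoundedUnder_of_eventually_le (hup 1 one_pos)
  have hcob : IsCoboundedUnder (· ≤ ·) atTop (fun t => |g t|) :=
    IsCoboundedUnder.of_frequently_ge (a := 0) (Frequently.of_forall fun t => abs_nonneg _)
  refine ⟨hbdd, le_of_forall_pos_le_add fun ε hε => ?_,
    le_of_forall_pos_le_add fun ε hε => limsup_le_of_le hcob (hup ε hε)⟩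
  rw [← sub_le_iff_le_add]
  refine le_limsup_of_frequently_le ?_ hbdd
  -- At the times where the phase is a multiple of `2π`, the sinusoid takes the value `a * v`.
  have hτ : Tendsto (fun m : ℕ => (m * (2 * Real.pi) - f) / ω) atTop atTop := by
    refine Tendsto.atTop_div_const hω (tendsto_atTop_add_const_right _ _ ?_)
    exact tendsto_natCast_atTop_atTop.atTop_mul_const (by positivity)
  refine hτ.frequently (Eventually.frequently ?_)
  filter_upwards [hτ.eventually (Metric.tendsto_nhds.1 hg ε hε)] with m hm
  have h0 : ω * ((m * (2 * Real.pi) - f) / ω) + f = m * (2 * Real.pi) := by field_simp; ring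
  have hsin : Real.sin (m * (2 * Real.pi)) = 0 := by
    simpa using Real.sin_add_nat_mul_two_pi 0 m
  rw [Real.dist_eq, sub_zero, h0, Real.cos_nat_mul_two_pi, hsin] at hm
  set y := g ((m * (2 * Real.pi) - f) / ω)
  have h2 := abs_sub_abs_le_abs_sub (a * (u * 0 + v * 1)) y
  rw [abs_sub_comm, abs_mul, abs_of_pos ha] at h2
  simp only [mul_zero, mul_one, zero_add] at h2 hm
  linarith

end LinearSystems

section SteadyStateBounds

/-! ### High-frequency behaviour of the steady-state response -/

variable {κ : Type*} [Fintype κ]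

theorem abs_mulVec_le (M : Matrix κ κ ℝ) {x : κ → ℝ} {r : ℝ} (hr : 0 ≤ r) (p : κ)
    (hx : ∀ q, M p q ≠ 0 → |x q| ≤ r) : |(M *ᵥ x) p| ≤ (∑ i, ∑ j, |M i j|) * r := by
  have h1 : ∑ j, |M p j| ≤ ∑ i, ∑ j, |M i j| :=
    Finset.single_le_sum (f := fun i => ∑ j, |M i j|)
      (fun i _ => Finset.sum_nonneg fun j _ => abs_nonneg _) (Finset.mem_univ p)
  refine le_trans ?_ (mul_le_mul_of_nonneg_right h1 hr)
  rw [Finset.sum_mul]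
  refine (Finset.abs_sum_le_sum_abs _ _).trans (Finset.sum_le_sum fun q _ => ?_)
  rw [abs_mul]
  by_cases h : M p q = 0
  · simp [h]
  · gcongr
    exact hx q h

/-- High-frequency decay of the steady-state response. If `δ p` is a lower bound for the number of
steps that the input `b` needs to reach the coordinate `p` in the graph of `M`, then the response
in that coordinate is `O(ω ^ -(δ p + 1))`. Each induction step gains one factor `ω⁻¹` from
`i ω w = M w + b`, whose `p`-th row involves only coordinates with `δ` at least `δ p - 1`. -/
theorem exists_steadyState_le (M : Matrix κ κ ℝ) (b : κ → ℝ) (δ : κ → ℕ)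
    (hM : ∀ p q, M p q ≠ 0 → δ p ≤ δ q + 1) (hb : ∀ p, δ p ≠ 0 → b p = 0) :
    ∃ ω₀ > 0, ∃ C > 0, ∀ ω > ω₀, ∀ u v : κ → ℝ, M *ᵥ u + b = -ω • v → M *ᵥ v = ω • u →
      ∀ p, |u p| ≤ C / ω ^ (δ p + 1) ∧ |v p| ≤ C / ω ^ (δ p + 1) := by
  set S : ℝ := ∑ i, ∑ j, |M i j| with hS
  have hS0 : 0 ≤ S := Finset.sum_nonneg fun i _ => Finset.sum_nonneg fun j _ => abs_nonneg _
  have key : ∀ j : ℕ, ∃ C > 0, ∀ ω > 2 * S + 1, ∀ u v : κ → ℝ, M *ᵥ u + b = -ω • v →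
      M *ᵥ v = ω • u → ∀ p, j ≤ δ p → |u p| ≤ C / ω ^ (j + 1) ∧ |v p| ≤ C / ω ^ (j + 1) := by
    intro j
    induction j with
    | zero =>
      refine ⟨2 * ‖b‖ + 1, by positivity, fun ω hω u v hu hv p _ => ?_⟩
      have hω0 : 0 < ω := by linarith
      -- The equations give `ω r ≤ S r + ‖b‖`, and `S r` is absorbed since `2 S ≤ ω`.
      set r : ℝ := max ‖u‖ ‖v‖ with hr
      have hr0 : 0 ≤ r := (norm_nonneg u).trans (le_max_left _ _)
      have hur : ∀ q, |u q| ≤ r := fun q => (norm_le_pi_norm u q).trans (le_max_left _ _)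
      have hvr : ∀ q, |v q| ≤ r := fun q => (norm_le_pi_norm v q).trans (le_max_right _ _)
      have hB : 0 ≤ (S * r + ‖b‖) / ω := by positivity
      have h1 : ‖u‖ ≤ (S * r + ‖b‖) / ω := by
        refine (pi_norm_le_iff_of_nonneg hB).2 fun q => ?_
        have h := congrFun hv q
        have h' := abs_mulVec_le M hr0 q fun q _ => hvr q
        rw [h, Pi.smul_apply, smul_eq_mul, abs_mul, abs_of_pos hω0] at h'
        rw [Real.norm_eq_abs, le_div_iff₀ hω0]
        have := norm_nonneg b
        linarith
      have h2 : ‖v‖ ≤ (S * r + ‖b‖) / ω := by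
        refine (pi_norm_le_iff_of_nonneg hB).2 fun q => ?_
        have h := congrFun hu q
        have h' := abs_mulVec_le M hr0 q fun q _ => hur q
        have h'' : |b q| ≤ ‖b‖ := norm_le_pi_norm b q
        have h3 : |ω * v q| ≤ |(M *ᵥ u) q| + |b q| := by
          have : ω * v q = -((M *ᵥ u) q + b q) := by
            have : (M *ᵥ u) q + b q = -(ω * v q) := by simpa using h
            rw [this, neg_neg]
          rw [this, abs_neg]
          exact abs_add_le _ _
        rw [abs_mul, abs_of_pos hω0] at h3
        rw [Real.norm_eq_abs, le_div_iff₀ hω0]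
        linarith
      have h3 : r ≤ (2 * ‖b‖ + 1) / ω := by
        have h4 : r ≤ (S * r + ‖b‖) / ω := max_le h1 h2
        rw [le_div_iff₀ hω0] at h4 ⊢
        nlinarith [mul_nonneg hr0 (sub_nonneg.2 hω.le)]
      simpa using ⟨(hur p).trans h3, (hvr p).trans h3⟩
    | succ j ih =>
      obtain ⟨C, hC, ih⟩ := ih
      refine ⟨(S + 1) * C, by positivity, fun ω hω u v hu hv p hp => ?_⟩
      have hω0 : 0 < ω := by linarith
      have hr0 : 0 ≤ C / ω ^ (j + 1) := by positivity
      have hq : ∀ q, M p q ≠ 0 → j ≤ δ q := fun q h => by have := hM p q h; omega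
      have e1 : (S + 1) * C / ω ^ (j + 1 + 1) = (S + 1) * (C / ω ^ (j + 1)) / ω := by
        rw [pow_succ ω (j + 1), ← mul_div_assoc, div_div]
      rw [e1, le_div_iff₀ hω0, le_div_iff₀ hω0]
      constructor
      · have h := congrFun hv p
        have h' := abs_mulVec_le M hr0 p fun q h => (ih ω hω u v hu hv q (hq q h)).2
        rw [h, Pi.smul_apply, smul_eq_mul, abs_mul, abs_of_pos hω0] at h'
        linarith
      · have h := congrFun hu p
        have h' := abs_mulVec_le M hr0 p fun q h => (ih ω hω u v hu hv q (hq q h)).1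
        rw [Pi.add_apply, hb p (by omega), add_zero] at h
        rw [h, Pi.smul_apply, smul_eq_mul, abs_mul, abs_neg, abs_of_pos hω0] at h'
        linarith
  choose C hC hbound using key
  refine ⟨2 * S + 1, by positivity, ∑ p, C (δ p) + 1, ?_, fun ω hω u v hu hv p => ?_⟩
  · have := Finset.sum_nonneg (s := Finset.univ) fun p (_ : p ∈ _) => (hC (δ p)).le
    linarith
  · have hω0 : 0 < ω := by linarith
    have h1 : C (δ p) ≤ ∑ p, C (δ p) + 1 := by
      have : C (δ p) ≤ ∑ p, C (δ p) :=
        Finset.single_le_sum (f := fun p => C (δ p)) (fun p _ => (hC (δ p)).le)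
          (Finset.mem_univ p)
      linarith
    have h2 : C (δ p) / ω ^ (δ p + 1) ≤ (∑ p, C (δ p) + 1) / ω ^ (δ p + 1) := by gcongr
    obtain ⟨h3, h4⟩ := hbound (δ p) ω hω u v hu hv p le_rfl
    exact ⟨h3.trans h2, h4.trans h2⟩

/-- A coordinate that the input enters directly responds with order at least `ω⁻¹`: in
`ω v = -(M u + b)` the term `M u` is itself `O(ω⁻¹)`. The bound is trivial where `b p = 0`. -/
theorem exists_le_steadyState (M : Matrix κ κ ℝ) (b : κ → ℝ) :
    ∃ ω₀ > 0, ∀ ω > ω₀, ∀ u v : κ → ℝ, M *ᵥ u + b = -ω • v → M *ᵥ v = ω • u →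
      ∀ p, |b p| / 2 ≤ ω * |v p| := by
  obtain ⟨ω₀, hω₀, C, hC, hbound⟩ :=
    exists_steadyState_le M b 0 (fun _ _ _ => Nat.zero_le _) (fun _ h => absurd rfl h)
  set S : ℝ := ∑ i, ∑ j, |M i j| with hS
  have hS0 : 0 ≤ S := Finset.sum_nonneg fun i _ => Finset.sum_nonneg fun j _ => abs_nonneg _
  have hsum : ∀ p ∈ Finset.univ, 0 ≤ 2 * (S * C) / |b p| := fun p _ => by positivity
  -- Coordinates with `b p = 0` contribute `0` to this threshold by the convention on division.
  refine ⟨ω₀ + ∑ p, 2 * (S * C) / |b p|, add_pos_of_pos_of_nonneg hω₀ (Finset.sum_nonneg hsum),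
    fun ω hω u v hu hv p => ?_⟩
  have hle := Finset.single_le_sum hsum (Finset.mem_univ p)
  have hω1 : ω > ω₀ := by linarith [Finset.sum_nonneg hsum]
  have hω0 : 0 < ω := hω₀.trans hω1
  rcases eq_or_ne (b p) 0 with h0 | h0
  · simp only [h0, abs_zero, zero_div]
    positivity
  have hr0 : 0 ≤ C / ω := by positivity
  have h1 := abs_mulVec_le M hr0 p fun q _ => by simpa using (hbound ω hω1 u v hu hv q).1
  have h2 : 2 * (S * C) / |b p| ≤ ω := by linarith
  rw [div_le_iff₀ (abs_pos.2 h0)] at h2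
  have h3 : S * (C / ω) ≤ |b p| / 2 := by
    rw [← mul_div_assoc, div_le_iff₀ hω0]
    linarith
  have h4 : (M *ᵥ u) p + b p = -(ω * v p) := by simpa using congrFun hu p
  have h5 : |b p| ≤ |ω * v p| + |(M *ᵥ u) p| := by
    have : b p = -(ω * v p) - (M *ᵥ u) p := by linarith
    rw [this]
    exact (abs_sub _ _).trans (by rw [abs_neg])
  rw [abs_mul, abs_of_pos hω0] at h5
  linarith

/-- Quotient of an amplitude of order at most `ω ^ -(δ + 1)` by one of order at least `ω⁻¹`. -/
theorem ratio_le {N D C β a ω : ℝ} {δ r : ℕ} (hC : 0 < C) (hβ : 0 < β) (ha : 0 < a)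
    (hω : 1 ≤ ω) (hr : r ≤ δ + 1)
    (hN : N ≤ a * (C / ω ^ (δ + 1) + C / ω ^ (δ + 1))) (hD : a * (β / 2 / ω) ≤ D) :
    0 < D ∧ N / D ≤ 4 * C / β * ω ^ (-((r : ℤ) - 1)) := by
  have hω0 : 0 < ω := by linarith
  have hD0 : 0 < D := lt_of_lt_of_le (by positivity) hD
  refine ⟨hD0, ?_⟩
  have h1 : (ω ^ δ)⁻¹ ≤ ω ^ (-((r : ℤ) - 1)) := by
    rw [← zpow_natCast, ← _root_.zpow_neg]
    exact zpow_le_zpow_right₀ hω (by omega)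
  rw [div_le_iff₀ hD0]
  calc N ≤ a * (C / ω ^ (δ + 1) + C / ω ^ (δ + 1)) := hN
    _ = 4 * C / β * (ω ^ δ)⁻¹ * (a * (β / 2 / ω)) := by
        rw [pow_succ]
        field_simp
        ring
    _ ≤ _ := by gcongr

end SteadyStateBounds

/-! ### Error equations of the two observers -/

theorem sum_fin_ite_val_eq {m : ℕ} (c : ℕ) (g : Fin m → ℝ) :
    ∑ j, (if j.val = c then g j else 0) = if h : c < m then g ⟨c, h⟩ else 0 := by
  split_ifs with h
  · simp [← Fin.ext_iff (b := ⟨c, h⟩)]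
  · exact Finset.sum_eq_zero fun j _ => if_neg (by have := j.isLt; omega)

theorem primeA_mulVec {m : ℕ} (x : Fin m → ℝ) (i : Fin m) :
    (primeA m *ᵥ x) i = if h : i.val + 1 < m then x ⟨i.val + 1, h⟩ else 0 := by
  rw [← sum_fin_ite_val_eq (i.val + 1) x]
  simp [primeA, mulVec, dotProduct]

theorem primeC_dotProduct {m : ℕ} (x : Fin m → ℝ) :
    primeC m ⬝ᵥ x = if h : 0 < m then x ⟨0, h⟩ else 0 := by
  rw [← sum_fin_ite_val_eq 0 x]
  simp [primeC, dotProduct]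

theorem standardField_sub_plantField {n : ℕ} (Φ K : Fin n → ℝ) (ℓ ν : ℝ) (x z : Fin n → ℝ) :
    standardField Φ K ℓ (output x ν) z - plantField Φ x
      = standardErrorMatrix Φ K ℓ *ᵥ (z - x) + ν • -(gainD n ℓ *ᵥ K) := by
  ext i
  simp [standardField, plantField, output, standardErrorMatrix, add_mulVec, vecMulVec_mulVec,
    mulVec_sub]
  ring

/-- The entry of `ξ` that estimates `x_i`. -/
def estIdx {n : ℕ} (hn : 2 ≤ n) (i : Fin n) : Idx n :=
  if h : i.val < n - 1 then (⟨i.val, h⟩, 0) else (⟨n - 2, by omega⟩, 1)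

theorem matL_apply {n : ℕ} (hn : 2 ≤ n) (i : Fin n) (p : Idx n) :
    matL n i p = if p = estIdx hn i then 1 else 0 := by
  obtain ⟨⟨j, hj⟩, a⟩ := p
  have hi := i.isLt
  simp only [matL, of_apply, estIdx]
  congr 1
  split_ifs with h <;> simp only [Prod.mk.injEq, Fin.mk.injEq, eq_iff_iff]
  · refine ⟨?_, Or.inl⟩
    rintro (h' | h')
    · exact h'
    · omega
  · refine ⟨?_, fun h' => Or.inr ⟨by omega, by omega, h'.2⟩⟩
    rintro (h' | h')
    · omega
    · exact ⟨by omega, h'.2.2⟩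

theorem matL_mulVec {n : ℕ} (hn : 2 ≤ n) (ξ : Idx n → ℝ) (i : Fin n) :
    (matL n *ᵥ ξ) i = ξ (estIdx hn i) := by
  simp [mulVec, dotProduct, matL_apply hn]

/-- The index of the entry of `x` that the entry `(i, a)` of `ξ` tracks, namely `i + a` (counted
from `0`). -/
def stateIdx {n : ℕ} (p : Idx n) : Fin n :=
  ⟨p.1.val + p.2.val, by have := p.1.isLt; have := p.2.isLt; omega⟩

theorem stateIdx_estIdx {n : ℕ} (hn : 2 ≤ n) (i : Fin n) : stateIdx (estIdx hn i) = i := by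
  have := i.isLt
  ext
  unfold estIdx stateIdx
  split_ifs <;> simp
  omega

/-- The direction through which the measured output enters the new observer. -/
noncomputable def newInput {n : ℕ} (k : Fin (n - 1) → Fin 2 → ℝ) (ℓ : ℝ) : Idx n → ℝ :=
  fun p => if p.1.val = 0 then (gainD 2 ℓ *ᵥ k p.1) p.2 else 0

/-- The new observer is affine, with linear part its error matrix. -/
theorem newField_eq {n : ℕ} (Φ : Fin n → ℝ) (k : Fin (n - 1) → Fin 2 → ℝ) (ℓ y : ℝ)
    (ξ : Idx n → ℝ) :
    newField Φ k ℓ y ξ = newErrorMatrix Φ k ℓ *ᵥ ξ + y • newInput k ℓ := by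
  ext ⟨i, a⟩
  have hi := i.isLt
  set G : Fin 2 → ℝ := gainD 2 ℓ *ᵥ k i with hG
  -- The index `i - 1` truncates for the first block, which has no lower neighbour; hence the inner
  -- case distinction.
  have hsplit : ∀ (j : Fin (n - 1)) (c : Fin 2), newErrorMatrix Φ k ℓ (i, a) (j, c) * ξ (j, c) =
      (if j.val = i.val then (primeA 2 - vecMulVec G (primeC 2)) a c * ξ (j, c) else 0)
      + (if j.val = i.val + 1 then matN a c * ξ (j, c) else 0)
      + (if j.val = i.val - 1 then
          (if i.val = 0 then 0 else vecMulVec G (primeB 2) a c * ξ (j, c)) else 0)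
      + (if i.val + 2 = n then primeB 2 a * (Φ ᵥ* matL n) (j, c) * ξ (j, c) else 0) := by
    intro j c
    simp only [newErrorMatrix, of_apply]
    split_ifs <;> first | omega | (try simp only [← hG]); ring
  have hΦ : ∑ j : Fin (n - 1), ∑ c, (Φ ᵥ* matL n) (j, c) * ξ (j, c) = Φ ⬝ᵥ (matL n *ᵥ ξ) := by
    rw [dotProduct_mulVec, dotProduct, Fintype.sum_prod_type]
  have hmul : (newErrorMatrix Φ k ℓ *ᵥ ξ) (i, a) =
      (primeA 2 *ᵥ block ξ i) a - ξ (i, 0) * G a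
      + (if h : i.val + 1 < n - 1 then (matN *ᵥ block ξ ⟨i.val + 1, h⟩) a else 0)
      + (if i.val = 0 then 0 else ξ (⟨i.val - 1, by omega⟩, 1) * G a)
      + (if i.val + 2 = n then primeB 2 a * (Φ ⬝ᵥ (matL n *ᵥ ξ)) else 0) := by
    have h1 : ∑ c, (primeA 2 - vecMulVec G (primeC 2)) a c * ξ (i, c) =
        (primeA 2 *ᵥ block ξ i) a - ξ (i, 0) * G a := by
      simp [primeC, vecMulVec_apply, block, mulVec, dotProduct]
      ring
    have h2 : ∑ c, vecMulVec G (primeB 2) a c * ξ (⟨i.val - 1, by omega⟩, c) =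
        ξ (⟨i.val - 1, by omega⟩, 1) * G a := by
      simp [primeB, vecMulVec_apply, mul_comm]
    have h3 : ∑ c, ∑ j, primeB 2 a * (Φ ᵥ* matL n) (j, c) * ξ (j, c) =
        primeB 2 a * (Φ ⬝ᵥ (matL n *ᵥ ξ)) := by
      rw [← hΦ, Finset.sum_comm]
      simp only [Finset.mul_sum, mul_assoc]
    rw [mulVec, dotProduct, Fintype.sum_prod_type, Finset.sum_comm]
    simp only [hsplit, Finset.sum_add_distrib, sum_fin_ite_val_eq, dif_pos hi]
    rw [h1]
    congr 1
    · congr 1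
      · congr 1
        split_ifs <;> simp [mulVec, dotProduct, block]
      · have h4 : i.val - 1 < n - 1 := by omega
        simp only [dif_pos h4]
        split_ifs
        · simp
        · exact h2
    · split_ifs
      · exact h3
      · simp
  rw [Pi.add_apply, hmul, Pi.smul_apply, newField]
  simp only [innov, newInput, primeC_dotProduct, Pi.add_apply, Pi.smul_apply, smul_eq_mul, ← hG]
  split_ifs <;> first | omega | (simp [primeB, block, dotProduct]; try ring)

/-- Without noise, the lifted state `(x_i, x_{i+1})_i` of the plant is itself a solution of the new
observer, because all injection terms vanish on it. -/
theorem newField_stateIdx {n : ℕ} (hn : 2 ≤ n) (Φ : Fin n → ℝ) (k : Fin (n - 1) → Fin 2 → ℝ)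
    (ℓ : ℝ) (x : Fin n → ℝ) :
    newField Φ k ℓ (output x 0) (fun p => x (stateIdx p)) =
      fun p => plantField Φ x (stateIdx p) := by
  ext ⟨i, a⟩
  have hi := i.isLt
  have hin : innov (output x 0) (fun p : Idx n => x (stateIdx p)) i = 0 := by
    have h0 : 0 < n := by omega
    by_cases h1 : i.val = 0
    · simp [innov, output, primeC_dotProduct, block, stateIdx, h0, h1]
    · have h2 : i.val - 1 + 1 = i.val := by omega
      simp [innov, primeC_dotProduct, primeB, block, stateIdx, h1, h2]
  have hL : matL n *ᵥ (fun p : Idx n => x (stateIdx p)) = x := by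
    ext j
    rw [matL_mulVec hn, stateIdx_estIdx]
  simp only [newField, hin, hL, plantField, zero_smul, Pi.add_apply, primeA_mulVec]
  have h1 : i.val + 1 < n := by omega
  fin_cases a
  · have h2 : i.val + 1 ≠ n := by omega
    by_cases hl : i.val + 1 < n - 1 <;>
      simp [primeB, stateIdx, matN, block, h1, h2, hl]
  · by_cases hl : i.val + 1 < n - 1
    · have h2 : i.val + 1 + 1 < n := by omega
      simp [primeB, stateIdx, matN, vecHead, vecTail, block, hl, h2, h2.ne]
    · have h2 : i.val + 1 + 1 = n := by omega
      simp [primeB, stateIdx, hl, h2]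

theorem newField_sub_plantField {n : ℕ} (hn : 2 ≤ n) (Φ : Fin n → ℝ)
    (k : Fin (n - 1) → Fin 2 → ℝ) (ℓ ν : ℝ) (x : Fin n → ℝ) (ξ : Idx n → ℝ) :
    newField Φ k ℓ (output x ν) ξ - (fun p => plantField Φ x (stateIdx p)) =
      newErrorMatrix Φ k ℓ *ᵥ (ξ - fun p => x (stateIdx p)) + ν • newInput k ℓ := by
  rw [← newField_stateIdx hn Φ k ℓ x, newField_eq, newField_eq, mulVec_sub]
  simp only [output, add_smul, add_zero]
  abel

theorem hasDerivWithinAt_standardError {n : ℕ} {Φ K : Fin n → ℝ} {ℓ : ℝ} {ν : ℝ → ℝ}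
    {x z : ℝ → Fin n → ℝ} {S : Set ℝ} (hx : IsIntegralCurveOn x (fun _ z => plantField Φ z) S)
    (hz : IsIntegralCurveOn z (fun t z => standardField Φ K ℓ (output (x t) (ν t)) z) S) :
    ∀ t ∈ S, HasDerivWithinAt (fun t => z t - x t)
      (standardErrorMatrix Φ K ℓ *ᵥ (z t - x t) + ν t • -(gainD n ℓ *ᵥ K)) S t := fun t ht =>
  ((hz t ht).sub (hx t ht)).congr_deriv (standardField_sub_plantField Φ K ℓ (ν t) (x t) (z t))

theorem hasDerivWithinAt_newError {n : ℕ} (hn : 2 ≤ n) {Φ : Fin n → ℝ}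
    {k : Fin (n - 1) → Fin 2 → ℝ} {ℓ : ℝ} {ν : ℝ → ℝ} {x : ℝ → Fin n → ℝ} {ξ : ℝ → Idx n → ℝ}
    {S : Set ℝ} (hx : IsIntegralCurveOn x (fun _ z => plantField Φ z) S)
    (hξ : IsIntegralCurveOn ξ (fun t z => newField Φ k ℓ (output (x t) (ν t)) z) S) :
    ∀ t ∈ S, HasDerivWithinAt (fun t => ξ t - fun p => x t (stateIdx p))
      (newErrorMatrix Φ k ℓ *ᵥ (ξ t - fun p => x t (stateIdx p)) + ν t • newInput k ℓ) S t :=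
  fun t ht =>
    have h : HasDerivWithinAt (fun t (p : Idx n) => x t (stateIdx p))
        (fun p => plantField Φ (x t) (stateIdx p)) S t :=
      hasDerivWithinAt_pi.2 fun p => hasDerivWithinAt_pi.1 (hx t ht) (stateIdx p)
    ((hξ t ht).sub h).congr_deriv (newField_sub_plantField hn Φ k ℓ (ν t) (x t) (ξ t))

/-! ### Propagation of the noise in the new observer -/

/-- A lower bound for the number of steps in which the noise reaches the entry `p` of the state of
the new observer. From the first block it needs `p.1` steps through the injection terms; or else it
passes through `Φ` from the first entry of some block of position at least `ρ` into the last block,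
and then back through the couplings `N`. The natural subtractions do not truncate for `n ≥ 2`. -/
noncomputable def delay {n : ℕ} (Φ : Fin n → ℝ) (p : Idx n) : ℕ :=
  min p.1.val (rho Φ + n - 1 - p.1.val - p.2.val)

theorem rho_le_of_ne_zero {n : ℕ} {Φ : Fin n → ℝ} {j : Fin n} (hj : Φ j ≠ 0) :
    rho Φ ≤ j.val + 1 := by
  classical
  have hmem : j ∈ Finset.univ.filter fun j => Φ j ≠ 0 := by simpa using hj
  rw [rho, dif_pos ⟨j, by convert hmem⟩]
  have := Finset.min'_le _ j hmem
  have h2 : (Finset.min' _ ⟨j, hmem⟩).val ≤ j.val := this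
  convert Nat.succ_le_succ h2

theorem one_le_rho {n : ℕ} (hn : 2 ≤ n) (Φ : Fin n → ℝ) : 1 ≤ rho Φ := by
  unfold rho
  split_ifs <;> omega

/-- `delay` grows by at most one along each edge of the graph of the error matrix. -/
theorem delay_le_of_newErrorMatrix_ne_zero {n : ℕ} (hn : 2 ≤ n) (Φ : Fin n → ℝ)
    (k : Fin (n - 1) → Fin 2 → ℝ) (ℓ : ℝ) (p q : Idx n) (h : newErrorMatrix Φ k ℓ p q ≠ 0) :
    delay Φ p ≤ delay Φ q + 1 := by
  have hρ := one_le_rho hn Φ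
  obtain ⟨⟨i, hi⟩, a⟩ := p
  obtain ⟨⟨j, hj⟩, c⟩ := q
  simp only [newErrorMatrix, of_apply] at h
  simp only [delay]
  have ha := a.isLt
  have hc := c.isLt
  -- An entry in the last block row that comes from `Φ` links to positions `≥ ρ` only.
  by_cases hfeed : i + 2 = n ∧ primeB 2 a * (Φ ᵥ* matL n) (⟨j, hj⟩, c) ≠ 0
  · obtain ⟨h1, h2⟩ := hfeed
    have h3 := right_ne_zero_of_mul h2
    obtain ⟨m, -, hm⟩ := Finset.exists_ne_zero_of_sum_ne_zero (s := Finset.univ)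
      (f := fun m => Φ m * matL n m (⟨j, hj⟩, c)) h3
    have h4 := rho_le_of_ne_zero (left_ne_zero_of_mul hm)
    have h5 := right_ne_zero_of_mul hm
    have h6 := m.isLt
    have h7 : a.val = 1 := by
      have := left_ne_zero_of_mul h2
      simp only [primeB, ne_eq, ite_eq_right_iff, one_ne_zero, imp_false, not_not] at this
      omega
    simp only [matL, of_apply, ne_eq, ite_eq_right_iff, one_ne_zero, imp_false, not_not] at h5
    rcases h5 with ⟨h5, h8⟩ | ⟨h5, h8, h9⟩
    · subst h8
      simp
      omega
    · subst h9
      simp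
      omega
  · have h0 : (if i + 2 = n then primeB 2 a * (Φ ᵥ* matL n) (⟨j, hj⟩, c) else 0) = 0 := by
      split_ifs with h1
      · by_contra h2
        exact hfeed ⟨h1, h2⟩
      · rfl
    rw [h0, add_zero] at h
    split_ifs at h with h1 h2 h3
    · omega
    · have : a.val = 1 ∧ c.val = 1 := by
        fin_cases a <;> fin_cases c <;> simp [matN] at h ⊢
      omega
    · have : c.val = 1 := by
        fin_cases c <;> simp [vecMulVec_apply, primeB] at h ⊢
      omega
    · exact absurd rfl h

theorem newInput_eq_zero_of_delay_ne_zero {n : ℕ} (Φ : Fin n → ℝ) (k : Fin (n - 1) → Fin 2 → ℝ)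
    (ℓ : ℝ) (p : Idx n) (h : delay Φ p ≠ 0) : newInput k ℓ p = 0 := by
  refine if_neg fun h0 => h ?_
  simp [delay, h0]

theorem relDeg_le_delay_add_one {n : ℕ} (hn : 2 ≤ n) (Φ : Fin n → ℝ) (i : Fin n) :
    relDeg Φ i ≤ delay Φ (estIdx hn i) + 1 := by
  have := i.isLt
  have := one_le_rho hn Φ
  unfold relDeg delay estIdx
  split_ifs <;> simp <;> omega

theorem one_le_relDeg {n : ℕ} (hn : 2 ≤ n) (Φ : Fin n → ℝ) (i : Fin n) : 1 ≤ relDeg Φ i := by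
  unfold relDeg
  omega

end HighGain

theorem proposition2 (n : ℕ) (hn : 2 ≤ n) (Φ : Fin n → ℝ) (K : Fin n → ℝ)
    (k : Fin (n - 1) → Fin 2 → ℝ) (ℓ : ℝ) (hℓ : ℓ ≠ 0) (hK : ∀ i, K i ≠ 0)
    (hstd : HighGain.IsHurwitz (HighGain.standardErrorMatrix Φ K ℓ))
    (hnew : HighGain.IsHurwitz (HighGain.newErrorMatrix Φ k ℓ)) :
    (∀ i : Fin n, 1 ≤ HighGain.relDeg Φ i) ∧
    ∃ ω₀ : ℝ, 0 < ω₀ ∧ ∃ c : Fin n → ℝ, (∀ i, 0 < c i) ∧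
      ∀ ω a f : ℝ, ω₀ < ω → 0 < a →
      ∀ (x xh : ℝ → Fin n → ℝ) (ξ : ℝ → HighGain.Idx n → ℝ),
        IsIntegralCurveOn x (fun _ z => HighGain.plantField Φ z) (Set.Ici 0) →
        IsIntegralCurveOn xh
          (fun t z => HighGain.standardField Φ K ℓ
            (HighGain.output (x t) (HighGain.noise a ω f t)) z) (Set.Ici 0) →
        IsIntegralCurveOn ξ
          (fun t z => HighGain.newField Φ k ℓ
            (HighGain.output (x t) (HighGain.noise a ω f t)) z) (Set.Ici 0) →
        ∀ i : Fin n,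
          Filter.IsBoundedUnder (· ≤ ·) Filter.atTop
            (fun t => |(HighGain.matL n).mulVec (ξ t) i - x t i|) ∧
          Filter.IsBoundedUnder (· ≤ ·) Filter.atTop (fun t => |xh t i - x t i|) ∧
          0 < Filter.limsup (fun t => |xh t i - x t i|) Filter.atTop ∧
          Filter.limsup (fun t => |(HighGain.matL n).mulVec (ξ t) i - x t i|) Filter.atTop /
              Filter.limsup (fun t => |xh t i - x t i|) Filter.atTop
            ≤ c i * ω ^ (-((HighGain.relDeg Φ i : ℤ) - 1)) := by
  refine ⟨HighGain.one_le_relDeg hn Φ, ?_⟩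
  obtain ⟨ω₁, -, C, hC, hupper⟩ := HighGain.exists_steadyState_le
    (HighGain.newErrorMatrix Φ k ℓ) (HighGain.newInput k ℓ) (HighGain.delay Φ)
    (HighGain.delay_le_of_newErrorMatrix_ne_zero hn Φ k ℓ)
    (HighGain.newInput_eq_zero_of_delay_ne_zero Φ k ℓ)
  set b : Fin n → ℝ := -(HighGain.gainD n ℓ).mulVec K with hb
  have hb0 : ∀ i, 0 < |b i| := fun i => by
    simp [hb, HighGain.gainD, Matrix.mulVec_diagonal, hℓ, hK i]
  obtain ⟨ω₂, -, hlower⟩ :=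
    HighGain.exists_le_steadyState (HighGain.standardErrorMatrix Φ K ℓ) b
  refine ⟨max 1 (max ω₁ ω₂), by positivity, fun i => 4 * C / |b i|,
    fun i => div_pos (by positivity) (hb0 i), fun ω a f hω ha x xh ξ hx hxh hξ i => ?_⟩
  obtain ⟨hω1, hω12⟩ := max_lt_iff.1 hω
  obtain ⟨hωu, hωl⟩ := max_lt_iff.1 hω12
  have hω0 : 0 < ω := one_pos.trans hω1
  obtain ⟨u, v, hu, hv⟩ := hstd.exists_steadyState b ω
  obtain ⟨u', v', hu', hv'⟩ := hnew.exists_steadyState (HighGain.newInput k ℓ) ω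
  obtain ⟨hbdd, hlow, -⟩ := HighGain.limsup_abs_of_tendsto_sub_sinusoid ha hω0
    (hstd.tendsto_sub_steadyState hu hv (HighGain.hasDerivWithinAt_standardError hx hxh) i)
  obtain ⟨hbdd', -, hup⟩ := HighGain.limsup_abs_of_tendsto_sub_sinusoid ha hω0
    (hnew.tendsto_sub_steadyState hu' hv' (HighGain.hasDerivWithinAt_newError hn hx hξ)
      (HighGain.estIdx hn i))
  have herr : ∀ t, (HighGain.matL n).mulVec (ξ t) i - x t i =
      (ξ t - fun p => x t (HighGain.stateIdx p)) (HighGain.estIdx hn i) := fun t => by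
    rw [HighGain.matL_mulVec hn, Pi.sub_apply, HighGain.stateIdx_estIdx]
  simp only [herr]
  obtain ⟨hu'le, hv'le⟩ := hupper ω hωu u' v' hu' hv' (HighGain.estIdx hn i)
  have hvle : |b i| / 2 / ω ≤ |v i| := by
    rw [div_le_iff₀ hω0, mul_comm]
    exact hlower ω hωl u v hu hv i
  exact ⟨hbdd', hbdd, HighGain.ratio_le hC (hb0 i) ha hω1.le
    (HighGain.relDeg_le_delay_add_one hn Φ i)
    (hup.trans (mul_le_mul_of_nonneg_left (add_le_add hu'le hv'le) ha.le))
    ((mul_le_mul_of_nonneg_left hvle ha.le).trans hlow)⟩
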